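/- Let $\Sigma$ be a finite alphabet. An $\mathbf{FO}[<]$ sentence over $\Sigma$ is a first-order sentence built from the unary predicates $Q_a$ ($a\in\Sigma$) and the binary predicates $<$ and $=$. It is interpreted in a word $w=w_1\cdots w_n\in\Sigma^*$ by letting variables range over the positions $1,\dots,n$ (no positions if $w$ is empty), by letting $Q_a x$ mean that position $x$ holds the letter $a$, and by letting $<$ be the natural order of positions. Let $\mathrm L(\mathbf{FO}[<])$ be the class of languages $\{w\in\Sigma^* : w\models\varphi\}$ with $\varphi$ an $\mathbf{FO}[<]$ sentence. A monoid is aperiodic if every group contained in it (a subsemigroup that is a group, whose identity may differ from that of the monoid) is trivial. Let $\mathrm L(\mathbf A)$ be the class of languages $L\subseteq\Sigma^*$ of the form $L=\rho^{-1}(F)$, where $\rho:\Sigma^*\to M$ is a homomorphism to a finite aperiodic monoid $M$ and $F\subseteq M$. The syntactic monoid of $L$ is $M(L)=\Sigma^*/{\equiv_L}$, where $x\equiv_L y$ means that $uxv\in L\Leftrightarrow uyv\in L$ for all $u,v\in\Sigma^*$. Let $\mathcal{SF}$ be the class of star-free languages, i.e. the smallest class of languages over $\Sigma$ that contains $\emptyset$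 and $\{a\}$ for each letter $a\in\Sigma$ and is closed under union, concatenation and complementation in $\Sigma^*$. Then, for every finite alphabet $\Sigma$, $$\mathrm L(\mathbf{FO}[<])=\mathrm L(\mathbf A)=\mathcal{SF},$$ and a language $L\subseteq\Sigma^*$ lies in this class if and only if its syntactic monoid $M(L)$ is finite and aperiodic. Moreover, $\mathbf{FO}[<]$-definability is decidable: there is an algorithm that, given a finite alphabet and a nondeterministic finite automaton over it, decides whether the language accepted by the automaton is definable by an $\mathbf{FO}[<]$ sentence over that alphabet. -/

import Mathlib

universe u v

namespace FOWords

/-! ### First-order logic over words with the order predicate -/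

/-- Predicate symbols of `FO[<]` over the alphabet `α`: a unary label predicate `Q_a` for every
letter `a`, and the binary predicate `<`. -/
inductive WordRel (α : Type u) : ℕ → Type u
  | label (a : α) : WordRel α 1
  | lt : WordRel α 2

/-- The relational first-order vocabulary of `FO[<]` over `α`. -/
def wordVocabulary (α : Type u) : FirstOrder.Language.{0, u} where
  Functions := fun _ => Empty
  Relations := WordRel α

/-- Interpretation of the predicate symbols on the positions of the word `w`. -/
def wordRelMap {α : Type u} (w : List α) :
    ∀ {n : ℕ}, WordRel α n → (Fin n → Fin w.length) → Prop
  | _, .label a, p => w.get (p 0) = a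
  | _, .lt, p => p 0 < p 1

/-- The word `w` as a first-order structure whose universe is the set of its positions
(empty if `w` is the empty word). -/
abbrev wordStructure {α : Type u} (w : List α) :
    (wordVocabulary α).Structure (Fin w.length) where
  funMap := fun f => f.elim
  RelMap := fun r p => wordRelMap w r p

/-- `w ⊨ φ`, for an `FO[<]` sentence `φ`. -/
def Models {α : Type u} (w : List α) (φ : (wordVocabulary α).Sentence) : Prop :=
  letI := wordStructure w
  φ.Realize (Fin w.length)

/-- `L_φ`, the language defined by the sentence `φ`. -/
def definedLanguage {α : Type u} (φ : (wordVocabulary α).Sentence) : Language α :=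
  {w : List α | Models w φ}

/-- `L(FO[<])` over the alphabet `α`. -/
def foLanguages (α : Type u) : Set (Language α) :=
  {L | ∃ φ : (wordVocabulary α).Sentence, definedLanguage φ = L}

/-! ### Aperiodic monoids, recognition, syntactic monoids -/

/-- The subsemigroup `S` of `M` is a group for the multiplication of `M`. Its identity element
need not be the identity of `M`. -/
def IsSubgroupOf {M : Type v} [Monoid M] (S : Subsemigroup M) : Prop :=
  ∃ e ∈ S, (∀ x ∈ S, e * x = x ∧ x * e = x) ∧ ∀ x ∈ S, ∃ y ∈ S, x * y = e ∧ y * x = e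

/-- A monoid is aperiodic (group-free) if all groups contained in it are trivial. -/
def IsAperiodic (M : Type v) [Monoid M] : Prop :=
  ∀ S : Subsemigroup M, IsSubgroupOf S → (S : Set M).Subsingleton

/-- `M` recognizes `L`: `L = ρ⁻¹(F)` for a homomorphism `ρ` from `α*` to `M` and some `F ⊆ M`. -/
def Recognizes {α : Type u} (M : Type v) [Monoid M] (L : Language α) : Prop :=
  ∃ (ρ : FreeMonoid α →* M) (F : Set M), ∀ w : List α, w ∈ L ↔ ρ (FreeMonoid.ofList w) ∈ F

/-- `L(A)` over the alphabet `α`: the languages recognized by some finite aperiodic monoid. -/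
def aperiodicLanguages (α : Type u) : Set (Language α) :=
  {L | ∃ (M : Type) (_ : Monoid M), Finite M ∧ IsAperiodic M ∧ Recognizes M L}

/-- The syntactic congruence of `L`: `x ≡ y` iff `uxv ∈ L ↔ uyv ∈ L` for all words `u`, `v`. -/
def syntacticCon {α : Type u} (L : Language α) : Con (FreeMonoid α) where
  r x y := ∀ u v : FreeMonoid α,
    FreeMonoid.toList (u * x * v) ∈ L ↔ FreeMonoid.toList (u * y * v) ∈ L
  iseqv := ⟨fun _ _ _ => Iff.rfl, fun h u v => (h u v).symm,
    fun h k u v => (h u v).trans (k u v)⟩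
  mul' := by
    intro a b c d hab hcd u v
    have h1 := hab u (c * v)
    have h2 := hcd (u * b) v
    simp only [mul_assoc] at h1 h2 ⊢
    exact h1.trans h2

/-- The syntactic monoid `α* / ≡` of `L`. -/
abbrev SyntacticMonoid {α : Type u} (L : Language α) : Type u :=
  (syntacticCon L).Quotient

/-! ### Star-free languages -/

/-- Languages described by an expression built from the letters and the empty set symbol with
union, concatenation and complementation. -/
inductive IsStarFree {α : Type u} : Language α → Prop
  | empty : IsStarFree (0 : Language α)
  | letter (a : α) : IsStarFree ({[a]} : Language α)
  | union {K L : Language α} : IsStarFree K → IsStarFree L → IsStarFree (K + L)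
  | concat {K L : Language α} : IsStarFree K → IsStarFree L → IsStarFree (K * L)
  | compl {L : Language α} : IsStarFree L → IsStarFree Lᶜ

/-- The class `SF` over the alphabet `α`. -/
def starFreeLanguages (α : Type u) : Set (Language α) :=
  {L | IsStarFree L}

/-! ### Finite automata as inputs of an algorithm -/

/-- Finite descriptions `(k, n, Δ, I, T)` of nondeterministic finite automata over the alphabet
`{0, …, k-1}` with states `{0, …, n-1}`, a list `Δ` of transitions `(q, a, q')`, a list `I` of
initial states and a list `T` of accepting states. -/
abbrev AutomatonCode : Type :=
  ℕ × ℕ × List (ℕ × ℕ × ℕ) × List ℕ × List ℕ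

/-- Size of the alphabet of the described automaton. -/
abbrev AutomatonCode.letters (c : AutomatonCode) : ℕ := c.1

/-- Number of states of the described automaton. -/
abbrev AutomatonCode.states (c : AutomatonCode) : ℕ := c.2.1

/-- The described automaton. List entries that are out of range play no role. -/
def AutomatonCode.toNFA (c : AutomatonCode) : NFA (Fin c.letters) (Fin c.states) where
  step q a := {q' | ((q : ℕ), (a : ℕ), (q' : ℕ)) ∈ c.2.2.1}
  start := {q | (q : ℕ) ∈ c.2.2.2.1}
  accept := {q | (q : ℕ) ∈ c.2.2.2.2}

end FOWords

/-!
The three descriptions of a language are shown to be equivalent along the cycle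
star-free → first-order definable → recognized by a finite aperiodic monoid → star-free.

*Star-free languages are definable.* Only concatenation needs an argument. A factorization of a
nonempty word is given by a cut position, and the quantifiers of a sentence can be relativized to
the positions before the cut, or to the remaining ones (`realizeIn_relativize`).

*Definable languages are aperiodic.* By induction on formulas, the words over the alphabet extended
by markings of the variables are recognized by a finite aperiodic monoid (`recognizedFormula`). An
atomic formula is decided by the first marked position, for which the idempotent monoid `FirstMark`
suffices. A quantifier is simulated by `OneMarked M`, whose elements `(m, X)` collect in `X ⊆ M` the
values of a word for all positions of the quantified variable; it is again aperiodic because in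
`mⁱ s mʲ` with large `i + j` one of the exponents lies in the range where the powers of `m` are
constant.

*Aperiodic languages are star-free.* This is Schützenberger's argument. In a finite aperiodic monoid
an element `m` is the only one that lies in its right ideal and in its left ideal and is a factor of
`m` (`IsAperiodic.eq_of_isFactor`). Each of the three conditions on the value of a word is
star-free in terms of the fibers of proper factors of `m` (`fiber_eq`), so that induction along
the order of two-sided ideals applies.

The syntactic monoid is a quotient of a submonoid of every recognizing monoid, and finite aperiodic
monoids are those in which every element satisfies `xⁿ = xⁿ⁺¹` for some `n`; this equation passes to
submonoids and quotients.

For decidability, the language of an automaton with `n` states is recognized by the transformations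
of the set of its sets of states, a monoid with `N = (2ⁿ)^(2ⁿ)` elements. By the pigeonhole
principle the exponent `N` is large enough for every element, and every element is the value of a
word of length at most `N`. So aperiodicity is tested by comparing `u xᴺ v` and `u xᴺ⁺¹ v` for
finitely many words (`mem_aperiodicLanguages_iff_bounded`), and the test is primitive recursive.
-/

namespace FOWords

/-! ### Aperiodicity as an equation -/

/-- If two powers of `x` with exponents `i < j` agree and the powers of `x` are eventually
constant, then they are constant from exponent `i` on. -/
theorem pow_stable_of_pow_eq {M : Type v} [Monoid M] {x : M} {i j n : ℕ} (hij : i < j)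
    (h : x ^ i = x ^ j) (hn : x ^ n = x ^ (n + 1)) {k : ℕ} (hk : i ≤ k) :
    x ^ k = x ^ (k + 1) := by
  obtain ⟨d, rfl⟩ := Nat.exists_eq_add_of_lt hij
  have hper : ∀ t, x ^ i = x ^ (i + t * (d + 1)) := by
    intro t
    induction t with
    | zero => simp
    | succ t ih =>
      rw [show i + (t + 1) * (d + 1) = (i + d + 1) + t * (d + 1) by ring, pow_add, ← h, ← pow_add,
        ← ih]
  have hn' : ∀ t, x ^ (n + t) = x ^ (n + t + 1) := by
    intro t
    rw [show n + t + 1 = (n + 1) + t by ring, pow_add, pow_add, ← hn]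
  have hi : x ^ i = x ^ (i + 1) := by
    obtain ⟨s, hs⟩ : ∃ s, i + n * (d + 1) = n + s := ⟨i + n * d, by ring⟩
    rw [pow_succ, hper n, hs, ← pow_succ]
    exact hn' s
  obtain ⟨s, rfl⟩ := Nat.exists_eq_add_of_le hk
  rw [show i + s + 1 = (i + 1) + s by ring, pow_add, pow_add, ← hi]

/-- For a finite monoid, group-freeness is the equational condition `xⁿ = xⁿ⁺¹`. If
`xⁱ = xⁱ⁺ᵖ`, the powers of `x` with exponent at least `i` form a cyclic group with identity
`xⁱᵖ`. -/
theorem isAperiodic_iff_exists_pow {M : Type v} [Monoid M] [Finite M] :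
    IsAperiodic M ↔ ∀ x : M, ∃ n, x ^ n = x ^ (n + 1) := by
  constructor
  · intro hM x
    obtain ⟨i₀, j₀, hij₀, h₀⟩ : ∃ i j : ℕ, i < j ∧ x ^ i = x ^ j := by
      obtain ⟨a, b, hab, h⟩ := Finite.exists_ne_map_eq_of_infinite (fun n : ℕ => x ^ n)
      rcases lt_or_gt_of_ne hab with h' | h'
      · exact ⟨a, b, h', h⟩
      · exact ⟨b, a, h', h.symm⟩
    obtain ⟨d, rfl⟩ := Nat.exists_eq_add_of_lt hij₀
    have hper : ∀ t k, i₀ ≤ k → x ^ k = x ^ (k + t * (d + 1)) := by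
      intro t k hk
      obtain ⟨s, rfl⟩ := Nat.exists_eq_add_of_le hk
      induction t with
      | zero => simp
      | succ t ih =>
        rw [show i₀ + s + (t + 1) * (d + 1) = (i₀ + d + 1) + (s + t * (d + 1)) by ring,
          pow_add x (i₀ + d + 1), ← h₀, ← pow_add, ← add_assoc, ← ih]
    let S : Subsemigroup M :=
      { carrier := {y | ∃ k, i₀ ≤ k ∧ y = x ^ k}
        mul_mem' := by
          rintro _ _ ⟨k, hk, rfl⟩ ⟨l, hl, rfl⟩
          exact ⟨k + l, by omega, (pow_add x k l).symm⟩ }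
    have hle : i₀ ≤ i₀ * (d + 1) := Nat.le_mul_of_pos_right _ (Nat.succ_pos d)
    have hS : IsSubgroupOf S := by
      refine ⟨x ^ (i₀ * (d + 1)), ⟨_, hle, rfl⟩, ?_, ?_⟩
      · rintro _ ⟨k, hk, rfl⟩
        rw [← pow_add, ← pow_add, add_comm (i₀ * (d + 1)) k]
        exact ⟨(hper i₀ k hk).symm, (hper i₀ k hk).symm⟩
      · rintro _ ⟨k, hk, rfl⟩
        -- The exponent is at least `i₀`, and adding `k` to it gives a multiple of the period `d + 1`.
        refine ⟨x ^ (k * d + i₀ * (d + 1)), ⟨_, by omega, rfl⟩, ?_⟩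
        have h1 : k + (k * d + i₀ * (d + 1)) = i₀ * (d + 1) + k * (d + 1) := by ring
        rw [← pow_add, ← pow_add, add_comm (k * d + i₀ * (d + 1)) k, h1]
        exact ⟨(hper k _ hle).symm, (hper k _ hle).symm⟩
    exact ⟨i₀, hM S hS ⟨i₀, le_rfl, rfl⟩ ⟨i₀ + 1, by omega, rfl⟩⟩
  · rintro h S ⟨e, -, hid, hinv⟩
    have key : ∀ x ∈ S, x = e := by
      intro x hx
      obtain ⟨y, hy, hxy, hyx⟩ := hinv x hx
      obtain ⟨n, hn⟩ := h x
      -- Multiplication by the inverse `y` cancels factors `x`, as long as one of them remains.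
      have hstep : ∀ n : ℕ, x ^ (n + 1) = x ^ (n + 2) → x = x * x := by
        intro n
        induction n with
        | zero => intro h; simpa [pow_succ] using h
        | succ n ih =>
          intro h
          refine ih ?_
          have h2 := congrArg (y * ·) h
          have h3 : ∀ k : ℕ, y * x ^ (k + 2) = x ^ (k + 1) := by
            intro k
            rw [pow_succ' x (k + 1), ← mul_assoc, hyx, pow_succ' x k, ← mul_assoc, (hid x hx).1]
          simpa only [h3] using h2
      have hxx : x = x * x := hstep n (by rw [pow_succ, hn, ← pow_succ])
      calc x = e * x := (hid x hx).1.symm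
        _ = y * (x * x) := by rw [← hyx, mul_assoc]
        _ = e := by rw [← hxx, hyx]
    intro x hx z hz
    rw [key x hx, key z hz]

theorem IsAperiodic.exists_pow {M : Type v} [Monoid M] [Finite M] (h : IsAperiodic M) (x : M) :
    ∃ n, x ^ n = x ^ (n + 1) :=
  isAperiodic_iff_exists_pow.1 h x

/-- Iterating `m = a m b` gives `m = aⁿ m bⁿ` for all `n`. If `aⁿ = aⁿ⁺¹`, a further factor `a`
on the left changes nothing, and likewise on the right. -/
theorem IsAperiodic.mul_eq_of_eq_mul_mul {M : Type v} [Monoid M] [Finite M] (h : IsAperiodic M)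
    {a m b : M} (hm : m = a * m * b) : a * m = m ∧ m * b = m := by
  have hpow : ∀ n : ℕ, m = a ^ n * m * b ^ n := by
    intro n
    induction n with
    | zero => simp
    | succ n ih =>
      conv_lhs => rw [ih, hm]
      rw [pow_succ a, pow_succ' b]
      simp only [mul_assoc]
  obtain ⟨n, hn⟩ := h.exists_pow a
  obtain ⟨k, hk⟩ := h.exists_pow b
  constructor
  · conv_lhs => rw [hpow n]
    rw [← mul_assoc, ← mul_assoc, ← pow_succ', ← hn, ← hpow]
  · conv_lhs => rw [hpow k]
    rw [mul_assoc, ← pow_succ, ← hk, ← hpow]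

/-! ### Recognition and the syntactic monoid -/

theorem Recognizes.of_mulEquiv {α : Type u} {M : Type v} {N : Type*} [Monoid M] [Monoid N]
    (e : M ≃* N) {L : Language α} (h : Recognizes M L) : Recognizes N L := by
  obtain ⟨ρ, F, hF⟩ := h
  exact ⟨e.toMonoidHom.comp ρ, e.symm ⁻¹' F, fun w => by simp [hF]⟩

theorem isAperiodic_of_mulEquiv {M : Type u} {N : Type v} [Monoid M] [Monoid N] [Finite M]
    (e : M ≃* N) (h : IsAperiodic M) : IsAperiodic N := by
  have : Finite N := Finite.of_equiv M e.toEquiv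
  rw [isAperiodic_iff_exists_pow] at h ⊢
  intro x
  obtain ⟨n, hn⟩ := h (e.symm x)
  refine ⟨n, e.symm.injective ?_⟩
  simpa using hn

/-- The universe of the recognizing monoid plays no role. -/
theorem mem_aperiodicLanguages_of_recognizes {α : Type u} {M : Type v} [Monoid M] [Finite M]
    (hM : IsAperiodic M) {L : Language α} (h : Recognizes M L) : L ∈ aperiodicLanguages α :=
  ⟨Shrink.{0} M, inferInstance, inferInstance,
    isAperiodic_of_mulEquiv (Shrink.mulEquiv : Shrink.{0} M ≃* M).symm hM,
    h.of_mulEquiv (Shrink.mulEquiv : Shrink.{0} M ≃* M).symm⟩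

theorem recognizes_syntacticMonoid {α : Type u} (L : Language α) :
    Recognizes (SyntacticMonoid L) L := by
  refine ⟨(syntacticCon L).mk', (syntacticCon L).mk' '' {x | FreeMonoid.toList x ∈ L}, ?_⟩
  intro w
  constructor
  · intro hw
    exact ⟨FreeMonoid.ofList w, hw, rfl⟩
  · rintro ⟨x, hx, hxw⟩
    have hrel : syntacticCon L x (FreeMonoid.ofList w) := (Con.eq _).1 hxw
    have := hrel 1 1
    simp only [one_mul, mul_one] at this
    exact this.1 hx

/-- Any monoid recognizing `L` identifies at most syntactically congruent words. -/
theorem syntacticCon_of_recognizes {α : Type u} {M : Type v} [Monoid M] {L : Language α}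
    {ρ : FreeMonoid α →* M} {F : Set M} (hF : ∀ w : List α, w ∈ L ↔ ρ (FreeMonoid.ofList w) ∈ F)
    {x y : FreeMonoid α} (h : ρ x = ρ y) : syntacticCon L x y := by
  intro u v
  rw [hF, hF]
  simp only [FreeMonoid.ofList_toList, map_mul, h]

theorem finite_syntacticMonoid_of_recognizes {α : Type u} {M : Type v} [Monoid M] [Finite M]
    {L : Language α} (h : Recognizes M L) : Finite (SyntacticMonoid L) := by
  obtain ⟨ρ, F, hF⟩ := h
  refine Finite.of_surjective
    (fun m : Set.range ρ => (syntacticCon L).mk' m.2.choose) ?_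
  intro q
  obtain ⟨x, rfl⟩ := (syntacticCon L).mk'_surjective q
  refine ⟨⟨ρ x, x, rfl⟩, (Con.eq _).2 (syntacticCon_of_recognizes hF ?_)⟩
  exact (⟨x, rfl⟩ : ∃ y, ρ y = ρ x).choose_spec

theorem mem_aperiodicLanguages_iff {α : Type u} {L : Language α} :
    L ∈ aperiodicLanguages α ↔ Finite (SyntacticMonoid L) ∧ IsAperiodic (SyntacticMonoid L) := by
  constructor
  · rintro ⟨M, _, _, hM, ρ, F, hF⟩
    have hfin := finite_syntacticMonoid_of_recognizes ⟨ρ, F, hF⟩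
    refine ⟨hfin, isAperiodic_iff_exists_pow.2 fun q => ?_⟩
    obtain ⟨x, rfl⟩ := (syntacticCon L).mk'_surjective q
    obtain ⟨n, hn⟩ := hM.exists_pow (ρ x)
    refine ⟨n, ?_⟩
    rw [← map_pow, ← map_pow]
    exact (Con.eq _).2 (syntacticCon_of_recognizes hF (by simpa using hn))
  · rintro ⟨_, h⟩
    exact mem_aperiodicLanguages_of_recognizes h (recognizes_syntacticMonoid L)

/-! ### Aperiodic recognition implies star-freeness -/

namespace IsStarFree

variable {α : Type u}

theorem top : IsStarFree (⊤ : Language α) := by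
  have h := (IsStarFree.empty (α := α)).compl
  rwa [show ((0 : Language α)ᶜ) = ⊤ from compl_bot] at h

theorem inter {K L : Language α} (hK : IsStarFree K) (hL : IsStarFree L) : IsStarFree (K ⊓ L) := by
  have h := (hK.compl.union hL.compl).compl
  have e : (Kᶜ + Lᶜ)ᶜ = K ⊓ L := by
    ext w
    change ¬ (¬ w ∈ K ∨ ¬ w ∈ L) ↔ w ∈ K ∧ w ∈ L
    tauto
  rwa [e] at h

theorem iUnion {ι : Type*} [Finite ι] {K : ι → Language α} (h : ∀ i, IsStarFree (K i)) :
    IsStarFree (⨆ i, K i) := by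
  have key : ∀ s : Set ι, s.Finite → IsStarFree (⨆ i ∈ s, K i) := by
    intro s hs
    induction s, hs using Set.Finite.induction_on with
    | empty =>
      rw [iSup_emptyset]
      exact IsStarFree.empty
    | insert _ _ ih =>
      rw [iSup_insert]
      exact (h _).union ih
  simpa using key Set.univ Set.finite_univ

theorem iUnion_prop {p : Prop} {K : Language α} (h : p → IsStarFree K) :
    IsStarFree (⨆ _ : p, K) := by
  by_cases hp : p
  · simpa [hp] using h hp
  · rw [iSup_neg hp]
    exact IsStarFree.empty

end IsStarFree

/-- The set of words mapped to `m` by `ρ`. -/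
def fiber {α : Type u} {M : Type v} [Monoid M] (ρ : FreeMonoid α →* M) (m : M) : Language α :=
  {w | ρ (FreeMonoid.ofList w) = m}

/-- `m` lies in the two-sided ideal generated by `n`. -/
def IsFactor {M : Type v} [Monoid M] (n m : M) : Prop := ∃ u v, m = u * n * v

theorem IsFactor.trans {M : Type v} [Monoid M] {a b c : M} (h : IsFactor a b) (k : IsFactor b c) :
    IsFactor a c := by
  obtain ⟨u, v, rfl⟩ := h
  obtain ⟨x, y, rfl⟩ := k
  exact ⟨x * u, v * y, by simp only [mul_assoc]⟩

/-- In a finite aperiodic monoid, `m` is the only element that lies in the right ideal and in the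
left ideal of `m` and has `m` as a multiple: the `H`-classes are trivial. -/
theorem IsAperiodic.eq_of_isFactor {M : Type v} [Monoid M] [Finite M] (h : IsAperiodic M)
    {s m x y : M} (hx : s = m * x) (hy : s = y * m) (hs : IsFactor s m) : s = m := by
  obtain ⟨u, v, hm⟩ := hs
  have h1 : m = u * m * (x * v) := by
    conv_lhs => rw [hm, hx]
    simp only [mul_assoc]
  have h2 : m = (u * y) * m * v := by
    conv_lhs => rw [hm, hy]
    simp only [mul_assoc]
  have h3 : m = u * s := by
    conv_lhs => rw [← (h.mul_eq_of_eq_mul_mul h2).1, mul_assoc, ← hy]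
  rw [h3, hx, ← mul_assoc, (h.mul_eq_of_eq_mul_mul h1).1]

/-- Elements having the identity as a multiple are trivial. -/
theorem IsAperiodic.eq_one_of_isFactor_one {M : Type v} [Monoid M] [Finite M] (h : IsAperiodic M)
    {n : M} (hn : IsFactor n 1) : n = 1 :=
  h.eq_of_isFactor (one_mul n).symm (mul_one n).symm hn

section Schutzenberger

variable {α : Type u} {M : Type v} [Monoid M] (ρ : FreeMonoid α →* M)

/-- The value of a word in `M`. -/
abbrev val (w : List α) : M := ρ (FreeMonoid.ofList w)

@[simp]
theorem val_nil : val ρ [] = 1 := map_one ρ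

theorem val_append (x y : List α) : val ρ (x ++ y) = val ρ x * val ρ y := by
  simp [val, FreeMonoid.ofList_append]

theorem val_cons (a : α) (y : List α) : val ρ (a :: y) = val ρ [a] * val ρ y :=
  val_append ρ [a] y

/-- `n` is a proper factor of `m`: it generates a strictly larger two-sided ideal. -/
def ProperFactor (n m : M) : Prop := IsFactor n m ∧ ¬ IsFactor m n

/-- Words `x a` such that appending `a` to `x` enters the right ideal of `m`, from a value that is
a proper factor of `m`. -/
def rightEntry (m : M) : Language α :=
  ⨆ n : M, ⨆ a : α, ⨆ _ : ProperFactor n m ∧ ∃ x, n * val ρ [a] = m * x,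
    fiber ρ n * ({[a]} : Language α)

/-- Words `a x` such that prepending `a` to `x` enters the left ideal of `m`, from a value that is
a proper factor of `m`. -/
def leftEntry (m : M) : Language α :=
  ⨆ n : M, ⨆ a : α, ⨆ _ : ProperFactor n m ∧ ∃ y, val ρ [a] * n = y * m,
    ({[a]} : Language α) * fiber ρ n

/-- Letters whose value is not a factor of `m`. -/
def badLetters (m : M) : Language α :=
  ⨆ a : α, ⨆ _ : ¬ IsFactor (val ρ [a]) m, ({[a]} : Language α)

/-- Words of length at least two whose value is not a factor of `m`, while the value of the inner
part is a proper factor of `m`. -/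
def badWords (m : M) : Language α :=
  ⨆ a : α, ⨆ n : M, ⨆ b : α,
    ⨆ _ : ProperFactor n m ∧ ¬ IsFactor (val ρ [a] * n * val ρ [b]) m,
      ({[a]} : Language α) * fiber ρ n * ({[b]} : Language α)

/-- A word whose value generates the right ideal of `m` has a shortest prefix with value in that
right ideal; before its last letter, aperiodicity forces the value to be a proper factor of `m`. -/
theorem exists_rightEntry [Finite M] (h : IsAperiodic M) {m : M} (hm : m ≠ 1) {x : M}
    (w : List α) (hw : m = val ρ w * x) (hmw : ∃ t, val ρ w = m * t) :
    w ∈ rightEntry ρ m * (⊤ : Language α) := by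
  induction w using List.reverseRecOn generalizing x with
  | nil =>
    obtain ⟨t, ht⟩ := hmw
    refine absurd (h.eq_one_of_isFactor_one ⟨1, t, ?_⟩) hm
    simpa using ht
  | append_singleton w a ih =>
    rw [val_append] at hw
    by_cases hmp : ∃ t, val ρ w = m * t
    · obtain ⟨y, hy, z, -, rfl⟩ := Language.mem_mul.1 (ih (by rw [hw, mul_assoc]) hmp)
      exact Language.mem_mul.2 ⟨y, hy, z ++ [a], Set.mem_univ _, by simp⟩
    · refine Language.mem_mul.2 ⟨w ++ [a], ?_, [], Set.mem_univ _, by simp⟩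
      have hpf : ProperFactor (val ρ w) m := by
        refine ⟨⟨1, val ρ [a] * x, by rw [one_mul, ← mul_assoc, ← hw]⟩, ?_⟩
        rintro ⟨u, v, huv⟩
        have h1 : m = u * m * (v * (val ρ [a] * x)) := by
          conv_lhs => rw [hw, huv]
          simp only [mul_assoc]
        exact hmp ⟨v, by rw [huv, (h.mul_eq_of_eq_mul_mul h1).1]⟩
      simp only [rightEntry, Language.mem_iSup]
      refine ⟨val ρ w, a, ⟨hpf, ?_⟩, Language.mem_mul.2 ⟨w, rfl, [a], rfl, rfl⟩⟩
      obtain ⟨t, ht⟩ := hmw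
      exact ⟨t, by rw [← val_append, ht]⟩

/-- The mirror image of `exists_rightEntry`, with suffixes and left ideals. -/
theorem exists_leftEntry [Finite M] (h : IsAperiodic M) {m : M} (hm : m ≠ 1) {x : M}
    (w : List α) (hw : m = x * val ρ w) (hmw : ∃ t, val ρ w = t * m) :
    w ∈ (⊤ : Language α) * leftEntry ρ m := by
  induction w generalizing x with
  | nil =>
    obtain ⟨t, ht⟩ := hmw
    refine absurd (h.eq_one_of_isFactor_one ⟨t, 1, ?_⟩) hm
    simpa using ht
  | cons a w ih =>
    rw [val_cons] at hw
    by_cases hmp : ∃ t, val ρ w = t * m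
    · obtain ⟨y, -, z, hz, rfl⟩ := Language.mem_mul.1 (ih (x := x * val ρ [a])
        (by rw [mul_assoc, ← hw]) hmp)
      exact Language.mem_mul.2 ⟨a :: y, Set.mem_univ _, z, hz, by simp⟩
    · refine Language.mem_mul.2 ⟨[], Set.mem_univ _, a :: w, ?_, by simp⟩
      have hpf : ProperFactor (val ρ w) m := by
        refine ⟨⟨x * val ρ [a], 1, by rw [mul_one, mul_assoc, ← hw]⟩, ?_⟩
        rintro ⟨u, v, huv⟩
        have h1 : m = (x * val ρ [a] * u) * m * v := by
          conv_lhs => rw [hw, huv]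
          simp only [mul_assoc]
        exact hmp ⟨u, by rw [huv, mul_assoc, (h.mul_eq_of_eq_mul_mul h1).2]⟩
      simp only [leftEntry, Language.mem_iSup]
      refine ⟨val ρ w, a, ⟨hpf, ?_⟩, Language.mem_mul.2 ⟨[a], rfl, w, rfl, rfl⟩⟩
      obtain ⟨t, ht⟩ := hmw
      exact ⟨t, by rw [← val_cons, ht]⟩

/-- A word whose value is not a factor of `m` contains a minimal factor with that property: it is
a letter, or its two maximal proper factors have values that are factors of `m`. In the second
case aperiodicity makes the inner part a proper factor of `m`. -/
theorem exists_bad_factor [Finite M] (h : IsAperiodic M) {m : M} (w : List α)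
    (hw : ¬ IsFactor (val ρ w) m) :
    w ∈ (⊤ : Language α) * (badLetters ρ m + badWords ρ m) * (⊤ : Language α) := by
  induction hl : w.length using Nat.strong_induction_on generalizing w with
  | _ l ih =>
  subst hl
  have extend : ∀ p w' q : List α, w = p ++ w' ++ q → w'.length < w.length →
      ¬ IsFactor (val ρ w') m →
      w ∈ (⊤ : Language α) * (badLetters ρ m + badWords ρ m) * (⊤ : Language α) := by
    rintro p w' q rfl hlt hw'
    obtain ⟨y, hy, z, -, rfl⟩ := Language.mem_mul.1 (ih w'.length hlt w' hw' rfl)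
    obtain ⟨s, -, t, ht, rfl⟩ := Language.mem_mul.1 hy
    exact Language.mem_mul.2 ⟨(p ++ s) ++ t, Language.mem_mul.2
      ⟨p ++ s, Set.mem_univ _, t, ht, rfl⟩, z ++ q, Set.mem_univ _, by simp⟩
  have whole : w ∈ badLetters ρ m + badWords ρ m → w ∈
      (⊤ : Language α) * (badLetters ρ m + badWords ρ m) * (⊤ : Language α) :=
    fun hb => Language.mem_mul.2 ⟨w, Language.mem_mul.2 ⟨[], Set.mem_univ _, w, hb, rfl⟩, [],
      Set.mem_univ _, by simp⟩
  rcases w with _ | ⟨a, t⟩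
  · exact absurd ⟨m, 1, by simp⟩ hw
  rcases List.eq_nil_or_concat t with rfl | ⟨g, b, rfl⟩
  · refine whole ((Language.mem_add _ _ _).2 (Or.inl ?_))
    simp only [badLetters, Language.mem_iSup]
    exact ⟨a, hw, rfl⟩
  by_cases hl : IsFactor (val ρ (a :: g)) m
  swap
  · exact extend [] (a :: g) [b] (by simp) (by simp) hl
  by_cases hr : IsFactor (val ρ (g ++ [b])) m
  swap
  · exact extend [a] (g ++ [b]) [] (by simp) (by simp) hr
  refine whole ((Language.mem_add _ _ _).2 (Or.inr ?_))
  simp only [badWords, Language.mem_iSup]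
  refine ⟨a, val ρ g, b, ⟨⟨IsFactor.trans ⟨val ρ [a], 1, by rw [mul_one, ← val_cons]⟩ hl, ?_⟩, ?_⟩,
    Language.mem_mul.2 ⟨a :: g, Language.mem_mul.2 ⟨[a], rfl, g, rfl, rfl⟩, [b], rfl, by simp⟩⟩
  · rintro ⟨u, v, hn⟩
    obtain ⟨x, y, hxy⟩ := hl
    obtain ⟨x', y', hxy'⟩ := hr
    rw [val_cons] at hxy
    rw [val_append] at hxy'
    have h1 : val ρ g = (u * x * val ρ [a]) * val ρ g * (y * v) := by
      conv_lhs => rw [hn, hxy]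
      simp only [mul_assoc]
    have h2 : val ρ g = (u * x') * val ρ g * (val ρ [b] * y' * v) := by
      conv_lhs => rw [hn, hxy']
      simp only [mul_assoc]
    have h3 := (h.mul_eq_of_eq_mul_mul h1).1
    have h4 := (h.mul_eq_of_eq_mul_mul h2).2
    refine hw (IsFactor.trans (b := val ρ g) ⟨u * x, y' * v, ?_⟩ ⟨x * val ρ [a], y, hxy.trans (by
      simp only [mul_assoc])⟩)
    rw [List.concat_eq_append, val_cons, val_append]
    conv_lhs => rw [← h4, ← h3]
    simp only [mul_assoc]
  · rw [val_cons] at hw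
    rwa [List.concat_eq_append, val_append, ← mul_assoc] at hw

theorem not_isFactor_of_bad {m : M} {w : List α}
    (hw : w ∈ (⊤ : Language α) * (badLetters ρ m + badWords ρ m) *
      (⊤ : Language α)) : ¬ IsFactor (val ρ w) m := by
  obtain ⟨y, hy, z, -, rfl⟩ := Language.mem_mul.1 hw
  obtain ⟨s, -, t, ht, rfl⟩ := Language.mem_mul.1 hy
  have key : ¬ IsFactor (val ρ t) m := by
    rcases (Language.mem_add _ _ _).1 ht with ht | ht
    · simp only [badLetters, Language.mem_iSup] at ht
      obtain ⟨a, ha, rfl⟩ := ht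
      exact ha
    · simp only [badWords, Language.mem_iSup] at ht
      obtain ⟨a, n, b, ⟨-, hn⟩, ht⟩ := ht
      obtain ⟨p, hp, q, rfl, rfl⟩ := Language.mem_mul.1 ht
      obtain ⟨r, rfl, g, rfl, rfl⟩ := Language.mem_mul.1 hp
      rwa [val_append, val_append]
  intro hf
  refine key (IsFactor.trans ⟨val ρ s, val ρ z, ?_⟩ hf)
  rw [val_append, val_append]

/-- Schützenberger's description of a fiber over `m ≠ 1`: the word enters the right ideal and the
left ideal of `m`, and stays a factor of `m`. -/
theorem fiber_eq [Finite M] (h : IsAperiodic M) {m : M} (hm : m ≠ 1) :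
    fiber ρ m = (rightEntry ρ m * (⊤ : Language α)) ⊓
      ((⊤ : Language α) * leftEntry ρ m) ⊓
      ((⊤ : Language α) * (badLetters ρ m + badWords ρ m) * (⊤ : Language α))ᶜ := by
  ext w
  constructor
  · intro hw
    have hw' : val ρ w = m := hw
    refine ⟨⟨exists_rightEntry ρ h hm (x := 1) w (by simp [hw']) ⟨1, by simp [hw']⟩,
      exists_leftEntry ρ h hm (x := 1) w (by simp [hw']) ⟨1, by simp [hw']⟩⟩, ?_⟩
    intro hbad
    exact not_isFactor_of_bad ρ hbad ⟨1, 1, by simp [hw']⟩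
  · rintro ⟨⟨hr, hl⟩, hbad⟩
    obtain ⟨y, hy, z, -, rfl⟩ := Language.mem_mul.1 hr
    simp only [rightEntry, Language.mem_iSup] at hy
    obtain ⟨n, a, ⟨-, x, hx⟩, hy⟩ := hy
    obtain ⟨p, rfl, q, rfl, rfl⟩ := Language.mem_mul.1 hy
    obtain ⟨y', -, z', hz', he⟩ := Language.mem_mul.1 hl
    simp only [leftEntry, Language.mem_iSup] at hz'
    obtain ⟨n', a', ⟨-, x', hx'⟩, hz'⟩ := hz'
    obtain ⟨p', rfl, q', rfl, rfl⟩ := Language.mem_mul.1 hz'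
    refine h.eq_of_isFactor (x := x * val ρ z) (y := val ρ y' * x') ?_ ?_ ?_
    · rw [← mul_assoc, ← hx]
      exact (val_append ρ _ _).trans (by rw [val_append])
    · rw [mul_assoc, ← hx', ← he]
      exact (val_append ρ _ _).trans (by rw [val_append])
    · by_contra hf
      exact hbad (exists_bad_factor ρ h _ hf)

theorem isStarFree_fiber_one [Finite α] [Finite M] (h : IsAperiodic M) :
    IsStarFree (fiber ρ 1) := by
  have e : fiber ρ 1 =
      ((⊤ : Language α) * badLetters ρ 1 * (⊤ : Language α))ᶜ := by
    ext w
    change val ρ w = 1 ↔ ¬ (w ∈ (⊤ : Language α) * badLetters ρ 1 * (⊤ : Language α))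
    constructor
    · intro hw hbad
      refine not_isFactor_of_bad ρ (m := 1) (w := w) ?_ ⟨1, 1, by simp [hw]⟩
      obtain ⟨y, hy, z, hz, rfl⟩ := Language.mem_mul.1 hbad
      obtain ⟨s, hs, t, ht, rfl⟩ := Language.mem_mul.1 hy
      exact Language.mem_mul.2 ⟨_, Language.mem_mul.2 ⟨s, hs, t, Or.inl ht, rfl⟩, z, hz, rfl⟩
    · intro hw
      have hletter : ∀ a ∈ w, val ρ [a] = 1 := by
        intro a ha
        by_contra hne
        obtain ⟨s, t, rfl⟩ := List.append_of_mem ha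
        refine hw (Language.mem_mul.2 ⟨s ++ [a], Language.mem_mul.2
          ⟨s, Set.mem_univ _, [a], ?_, rfl⟩, t, Set.mem_univ _, by simp⟩)
        simp only [badLetters, Language.mem_iSup]
        exact ⟨a, fun hf => hne (h.eq_one_of_isFactor_one hf), rfl⟩
      clear hw
      induction w with
      | nil => simp [val]
      | cons a w ih =>
        rw [val_cons, hletter a (by simp), ih fun b hb => hletter b (by simp [hb]), one_mul]
  rw [e]
  exact ((IsStarFree.top.concat (IsStarFree.iUnion fun a => IsStarFree.iUnion_prop fun _ =>
    IsStarFree.letter a)).concat IsStarFree.top).compl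

/-- Fibers of a homomorphism to a finite aperiodic monoid are star-free, by induction along the
order of two-sided ideals. -/
theorem isStarFree_fiber [Finite α] [Finite M] (h : IsAperiodic M) (m : M) :
    IsStarFree (fiber ρ m) := by
  induction hk : Set.ncard {n : M | IsFactor n m} using Nat.strong_induction_on generalizing m with
  | _ k ih =>
  subst hk
  by_cases hm : m = 1
  · subst hm
    exact isStarFree_fiber_one ρ h
  have ih' : ∀ n, ProperFactor n m → IsStarFree (fiber ρ n) := by
    rintro n ⟨hnm, hmn⟩
    refine ih _ (Set.ncard_lt_ncard ⟨fun x hx => hx.trans hnm, fun hsub => hmn ?_⟩) n rfl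
    exact hsub (show IsFactor m m from ⟨1, 1, by simp⟩)
  rw [fiber_eq ρ h hm]
  refine ((IsStarFree.concat ?_ .top).inter (IsStarFree.concat .top ?_)).inter
    ((IsStarFree.top.concat (IsStarFree.union ?_ ?_)).concat .top).compl
  · exact .iUnion fun n => .iUnion fun a => .iUnion_prop fun hn => (ih' n hn.1).concat (.letter a)
  · exact .iUnion fun n => .iUnion fun a => .iUnion_prop fun hn =>
      (IsStarFree.letter a).concat (ih' n hn.1)
  · exact .iUnion fun a => .iUnion_prop fun _ => .letter a
  · exact .iUnion fun a => .iUnion fun n => .iUnion fun b => .iUnion_prop fun hn =>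
      ((IsStarFree.letter a).concat (ih' n hn.1)).concat (.letter b)

end Schutzenberger

theorem isStarFree_of_mem_aperiodicLanguages {α : Type u} [Finite α] {L : Language α}
    (hL : L ∈ aperiodicLanguages α) : IsStarFree L := by
  obtain ⟨M, _, _, hM, ρ, F, hF⟩ := hL
  have e : L = ⨆ m : F, fiber ρ m := by
    ext w
    rw [hF, Language.mem_iSup]
    exact ⟨fun hw => ⟨⟨_, hw⟩, rfl⟩, fun ⟨m, hm⟩ => (show _ = _ from hm) ▸ m.2⟩
  rw [e]
  exact .iUnion fun m => isStarFree_fiber ρ hM m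

open FirstOrder

/-! ### Closure properties of finite aperiodic monoids -/

theorem pow_stable_of_le {M : Type v} [Monoid M] {x : M} {n k : ℕ} (hn : x ^ n = x ^ (n + 1))
    (hk : n ≤ k) : x ^ k = x ^ (k + 1) :=
  pow_stable_of_pow_eq (Nat.lt_succ_self n) hn hn hk

theorem IsAperiodic.prod {M : Type u} {N : Type v} [Monoid M] [Monoid N] [Finite M] [Finite N]
    (hM : IsAperiodic M) (hN : IsAperiodic N) : IsAperiodic (M × N) := by
  refine isAperiodic_iff_exists_pow.2 fun x => ?_
  obtain ⟨n, hn⟩ := hM.exists_pow x.1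
  obtain ⟨k, hk⟩ := hN.exists_pow x.2
  exact ⟨n + k, Prod.ext (pow_stable_of_le hn (Nat.le_add_right n k))
    (pow_stable_of_le hk (Nat.le_add_left k n))⟩

/-- The monoid `T ∪ {1}` in which a product is its first factor different from `1`; the identity
is represented by `none`. -/
@[ext]
structure FirstMark (T : Type v) where
  /-- The element of `T`, if the represented element is not the identity. -/
  first : Option T

namespace FirstMark

variable {T : Type v}

instance : Monoid (FirstMark T) where
  mul x y := ⟨x.first.or y.first⟩
  one := ⟨none⟩
  mul_assoc _ _ _ := FirstMark.ext Option.or_assoc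
  one_mul _ := FirstMark.ext Option.none_or
  mul_one _ := FirstMark.ext Option.or_none

theorem mul_first (x y : FirstMark T) : (x * y).first = x.first.or y.first := rfl

instance [Finite T] : Finite (FirstMark T) :=
  Finite.of_injective FirstMark.first fun _ _ => FirstMark.ext

theorem isAperiodic [Finite T] : IsAperiodic (FirstMark T) := by
  refine isAperiodic_iff_exists_pow.2 fun x => ⟨1, FirstMark.ext ?_⟩
  rw [pow_succ x 1, pow_one, mul_first, Option.or_self]

theorem lift_ofList_first {β : Type u} (f : β → Option T) (l : List β) :
    (FreeMonoid.lift (fun b => FirstMark.mk (f b)) (FreeMonoid.ofList l)).first =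
      l.findSome? f := by
  induction l with
  | nil => rfl
  | cons a l ih =>
    rw [FreeMonoid.ofList_cons, map_mul, mul_first, ih, FreeMonoid.lift_eval_of,
      List.findSome?_cons]
    cases f a <;> rfl

end FirstMark

/-- The upper triangular matrices with equal diagonal entries `m ∈ M` and with upper right entry
a subset of `M`. A word over letters `(m, X)` has as its second component all products obtained
by choosing one position, taking an element of `X` there, and taking `m` at all other
positions. -/
@[ext]
structure OneMarked (M : Type v) where
  /-- The product without a chosen position. -/
  plain : M
  /-- The products with one chosen position. -/
  marked : Set M

namespace OneMarked

open scoped Pointwise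

variable {M : Type v} [Monoid M]

instance : Monoid (OneMarked M) where
  mul x y := ⟨x.plain * y.plain, (· * y.plain) '' x.marked ∪ (x.plain * ·) '' y.marked⟩
  one := ⟨1, ∅⟩
  mul_assoc x y z := by
    refine OneMarked.ext (mul_assoc _ _ _) ?_
    change (· * z.plain) '' ((· * y.plain) '' x.marked ∪ (x.plain * ·) '' y.marked) ∪
        (x.plain * y.plain * ·) '' z.marked =
      (· * (y.plain * z.plain)) '' x.marked ∪
        (x.plain * ·) '' ((· * z.plain) '' y.marked ∪ (y.plain * ·) '' z.marked)
    simp only [Set.image_union, Set.image_image, mul_assoc, Set.union_assoc]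
  one_mul x := by
    refine OneMarked.ext (one_mul _) ?_
    change (· * x.plain) '' (∅ : Set M) ∪ (1 * ·) '' x.marked = x.marked
    simp
  mul_one x := by
    refine OneMarked.ext (mul_one _) ?_
    change (· * (1 : M)) '' x.marked ∪ (x.plain * ·) '' (∅ : Set M) = x.marked
    simp

theorem mul_plain (x y : OneMarked M) : (x * y).plain = x.plain * y.plain := rfl

theorem mem_mul_marked {x y : OneMarked M} {z : M} : z ∈ (x * y).marked ↔
    (∃ s ∈ x.marked, s * y.plain = z) ∨ ∃ s ∈ y.marked, x.plain * s = z := Iff.rfl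

instance [Finite M] : Finite (OneMarked M) :=
  Finite.of_injective (fun x : OneMarked M => (x.plain, x.marked)) fun _ _ h =>
    OneMarked.ext (congrArg Prod.fst h) (congrArg Prod.snd h)

theorem one_plain : (1 : OneMarked M).plain = 1 := rfl

theorem pow_plain (x : OneMarked M) (n : ℕ) : (x ^ n).plain = x.plain ^ n := by
  induction n with
  | zero => rw [pow_zero, pow_zero, one_plain]
  | succ n ih => rw [pow_succ, pow_succ, mul_plain, ih]

theorem mem_pow_succ_marked {x : OneMarked M} {n : ℕ} {z : M} : z ∈ (x ^ (n + 1)).marked ↔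
    ∃ i j, i + j = n ∧ ∃ s ∈ x.marked, x.plain ^ i * s * x.plain ^ j = z := by
  induction n generalizing z with
  | zero => simp
  | succ n ih =>
    rw [pow_succ, mem_mul_marked, pow_plain]
    simp only [ih]
    constructor
    · rintro (⟨_, ⟨i, j, rfl, s, hs, rfl⟩, rfl⟩ | ⟨s, hs, rfl⟩)
      · exact ⟨i, j + 1, by omega, s, hs, by simp only [pow_succ, mul_assoc]⟩
      · exact ⟨n + 1, 0, rfl, s, hs, by simp⟩
    · rintro ⟨i, _ | j, hij, s, hs, rfl⟩
      · obtain rfl : i = n + 1 := hij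
        exact Or.inr ⟨s, hs, by simp⟩
      · exact Or.inl ⟨_, ⟨i, j, by omega, s, hs, rfl⟩, by
          simp only [pow_succ, mul_assoc]⟩

/-- If `mᴺ = mᴺ⁺¹`, then in a product `mⁱ s mʲ` with `i + j ≥ 2N` one of the exponents can be
raised or lowered by one. -/
theorem isAperiodic [Finite M] (h : IsAperiodic M) : IsAperiodic (OneMarked M) := by
  refine isAperiodic_iff_exists_pow.2 fun x => ?_
  obtain ⟨N, hN⟩ := h.exists_pow x.plain
  refine ⟨2 * N + 1, OneMarked.ext ?_ (Set.ext fun z => ?_)⟩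
  · rw [pow_plain, pow_plain]
    exact pow_stable_of_le hN (by omega)
  · rw [mem_pow_succ_marked, mem_pow_succ_marked]
    constructor
    · rintro ⟨i, j, hij, s, hs, rfl⟩
      by_cases hi : N ≤ i
      · exact ⟨i + 1, j, by omega, s, hs, by rw [← pow_stable_of_le hN hi]⟩
      · exact ⟨i, j + 1, by omega, s, hs, by rw [← pow_stable_of_le hN (show N ≤ j by omega)]⟩
    · rintro ⟨i, j, hij, s, hs, rfl⟩
      by_cases hi : N + 1 ≤ i
      · obtain ⟨i, rfl⟩ := Nat.exists_eq_add_of_le' (Nat.one_le_of_lt hi)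
        exact ⟨i, j, by omega, s, hs, by rw [← pow_stable_of_le hN (show N ≤ i by omega)]⟩
      · obtain ⟨j, rfl⟩ := Nat.exists_eq_add_of_le' (show 1 ≤ j by omega)
        exact ⟨i, j, by omega, s, hs, by rw [← pow_stable_of_le hN (show N ≤ j by omega)]⟩

end OneMarked

/-! ### First-order definability implies aperiodic recognition -/

/-- Satisfaction of a formula with bound variables in the structure of a word. -/
def RealizeIn {α : Type u} {V : Type*} {n : ℕ} (w : List α)
    (φ : (wordVocabulary α).BoundedFormula V n) (x : V → Fin w.length)
    (v : Fin n → Fin w.length) : Prop :=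
  letI := wordStructure w
  φ.Realize x v

theorem models_iff_realizeIn {α : Type u} {w : List α} {φ : (wordVocabulary α).Sentence}
    {x : Empty → Fin w.length} {v : Fin 0 → Fin w.length} :
    Models w φ ↔ RealizeIn w φ x v := by
  rw [Subsingleton.elim x default, Subsingleton.elim v default]
  rfl

/-- The vocabulary has no function symbols, so terms are variables. -/
theorem exists_eq_var {α : Type u} {V : Type*} (t : (wordVocabulary α).Term V) :
    ∃ x, t = Language.Term.var x := by
  cases t with
  | var x => exact ⟨x, rfl⟩
  | func f => exact f.elim

section Marked

variable {α : Type u} {n : ℕ}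

/-- The letters of `α` together with the set of variables placed at a position. -/
abbrev MarkedLetter (α : Type u) (n : ℕ) : Type u := α × (Fin n → Prop)

/-- The word `w` in which each position records which of the variables `v` point to it. -/
def markedWord (w : List α) (v : Fin n → Fin w.length) : List (MarkedLetter α n) :=
  List.ofFn fun i => (w.get i, fun j => v j = i)

/-- Add the information whether the next variable points to the position. -/
def addMark (p : Prop) (c : MarkedLetter α n) : MarkedLetter α (n + 1) :=
  (c.1, Fin.snoc (α := fun _ => Prop) c.2 p)

theorem mapIdx_addMark_false (l : List (MarkedLetter α n)) :
    (l.mapIdx fun _ c => addMark False c) = l.map (addMark False) :=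
  List.ext_getElem (by simp) fun i _ _ => by simp

theorem markedWord_snoc (w : List α) (v : Fin n → Fin w.length) (y : Fin w.length) :
    markedWord w (Fin.snoc (α := fun _ => Fin w.length) v y) =
      (markedWord w v).mapIdx fun i c => addMark (i = y) c := by
  refine List.ext_getElem (by simp [markedWord]) fun i hi _ => ?_
  simp only [markedWord, List.getElem_ofFn, List.getElem_mapIdx, addMark]
  refine Prod.ext rfl (funext fun j => ?_)
  refine Fin.lastCases ?_ (fun j => ?_) j
  · simp [Fin.ext_iff, eq_comm]
  · simp

/-- The set of marked words of a formula is recognized by a finite aperiodic monoid. Nothing is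
required of words over the marked alphabet that do not come from an assignment. -/
def RecognizedFormula (φ : (wordVocabulary α).BoundedFormula Empty n) : Prop :=
  ∃ (M : Type) (_ : Monoid M), Finite M ∧ IsAperiodic M ∧
    ∃ (ρ : FreeMonoid (MarkedLetter α n) →* M) (F : Set M), ∀ w v,
      RealizeIn w φ default v ↔ val ρ (markedWord w v) ∈ F

/-- An atomic property is recognized if it is revealed by the first position at which `f` is
defined. -/
theorem recognizedFormula_of_first {φ : (wordVocabulary α).BoundedFormula Empty n}
    (f : MarkedLetter α n → Option Prop)
    (hf : ∀ w v, ∃ p : Fin w.length,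
      f (w.get p, fun j => v j = p) = some (RealizeIn w φ default v) ∧
      ∀ q < p, f (w.get q, fun j => v j = q) = none) : RecognizedFormula φ := by
  refine ⟨FirstMark Prop, inferInstance, inferInstance, FirstMark.isAperiodic,
    FreeMonoid.lift fun c => ⟨f c⟩, {x | x.first = some True}, fun w v => ?_⟩
  obtain ⟨p, hp, hq⟩ := hf w v
  have key : (markedWord w v).findSome? f = some (RealizeIn w φ default v) := by
    rw [List.findSome?_eq_some_iff]
    have hlen : (p : ℕ) < (markedWord w v).length := by simp [markedWord]
    refine ⟨(markedWord w v).take p, (markedWord w v)[(p : ℕ)], (markedWord w v).drop (p + 1),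
      by simp, by simpa [markedWord] using hp, fun c hc => ?_⟩
    obtain ⟨i, hi, rfl⟩ := List.getElem_of_mem hc
    have hip : i < p := lt_of_lt_of_le hi (by simp)
    simpa [markedWord] using hq ⟨i, hip.trans p.2⟩ hip
  rw [val, Set.mem_ofPred_eq, FirstMark.lift_ofList_first, key]
  simp

open Classical in
theorem recognizedFormula_equal (t₁ t₂ : (wordVocabulary α).Term (Empty ⊕ Fin n)) :
    RecognizedFormula (Language.BoundedFormula.equal t₁ t₂) := by
  obtain ⟨x | i, rfl⟩ := exists_eq_var t₁
  · exact x.elim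
  obtain ⟨x | j, rfl⟩ := exists_eq_var t₂
  · exact x.elim
  refine recognizedFormula_of_first (fun c => if c.2 i then some (c.2 j) else none) fun w v =>
    ⟨v i, ?_, fun q hq => if_neg hq.ne'⟩
  rw [if_pos rfl]
  exact congrArg some (propext ⟨fun h => h.symm, fun h => h.symm⟩)

open Classical in
theorem recognizedFormula_rel {k : ℕ} (R : (wordVocabulary α).Relations k)
    (ts : Fin k → (wordVocabulary α).Term (Empty ⊕ Fin n)) :
    RecognizedFormula (Language.BoundedFormula.rel R ts) := by
  cases R with
  | label a =>
    obtain ⟨x | i, hi⟩ := exists_eq_var (ts 0)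
    · exact x.elim
    refine recognizedFormula_of_first (fun c => if c.2 i then some (c.1 = a) else none) fun w v =>
      ⟨v i, ?_, fun q hq => if_neg hq.ne'⟩
    rw [if_pos rfl]
    refine congrArg some (propext ?_)
    let _ := wordStructure w
    change _ ↔ w.get ((ts 0).realize _) = a
    rw [hi]
    rfl
  | lt =>
    obtain ⟨x | i, hi⟩ := exists_eq_var (ts 0)
    · exact x.elim
    obtain ⟨x | j, hj⟩ := exists_eq_var (ts 1)
    · exact x.elim
    have hR : ∀ w v, RealizeIn w (Language.BoundedFormula.rel (WordRel.lt :
        (wordVocabulary α).Relations 2) ts) default v ↔ v i < v j := by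
      intro w v
      let _ := wordStructure w
      change ((ts 0).realize _ : Fin w.length) < (ts 1).realize _ ↔ _
      rw [hi, hj]
      rfl
    -- The first position carrying one of the two variables decides which one comes first.
    refine recognizedFormula_of_first
      (fun c => if c.2 j then some False else if c.2 i then some True else none) fun w v => ?_
    by_cases h : v i < v j
    · refine ⟨v i, ?_, fun q hq => ?_⟩
      · simp [hR, h, h.ne']
      · simp [hq.ne', (hq.trans h).ne']
    · refine ⟨v j, ?_, fun q hq => ?_⟩
      · simp [hR, h]
      · simp [hq.ne', (hq.trans_le (not_lt.1 h)).ne']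

theorem RecognizedFormula.imp {φ ψ : (wordVocabulary α).BoundedFormula Empty n}
    (hφ : RecognizedFormula φ) (hψ : RecognizedFormula ψ) : RecognizedFormula (φ.imp ψ) := by
  obtain ⟨M, _, _, hM, ρ, F, hF⟩ := hφ
  obtain ⟨N, _, _, hN, σ, G, hG⟩ := hψ
  refine ⟨M × N, inferInstance, inferInstance, hM.prod hN, ρ.prod σ,
    {x | x.1 ∈ F → x.2 ∈ G}, fun w v => ?_⟩
  change (RealizeIn w φ default v → RealizeIn w ψ default v) ↔ _
  rw [hF, hG]
  rfl

/-- The homomorphism to `OneMarked M` that simulates all ways of marking one position. -/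
def markHom {M : Type v} [Monoid M] (ρ : FreeMonoid (MarkedLetter α (n + 1)) →* M) :
    FreeMonoid (MarkedLetter α n) →* OneMarked M :=
  FreeMonoid.lift fun c => ⟨val ρ [addMark False c], {val ρ [addMark True c]}⟩

theorem val_markHom_plain {M : Type v} [Monoid M] (ρ : FreeMonoid (MarkedLetter α (n + 1)) →* M)
    (l : List (MarkedLetter α n)) :
    (val (markHom ρ) l).plain = val ρ (l.map (addMark False)) := by
  induction l with
  | nil => rw [val_nil, List.map_nil, val_nil, OneMarked.one_plain]
  | cons c l ih =>
    rw [val_cons, OneMarked.mul_plain, ih, List.map_cons, val_cons ρ]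
    simp [val, markHom]

theorem mem_val_markHom_marked {M : Type v} [Monoid M]
    (ρ : FreeMonoid (MarkedLetter α (n + 1)) →* M) (l : List (MarkedLetter α n)) (x : M) :
    x ∈ (val (markHom ρ) l).marked ↔
      ∃ y < l.length, x = val ρ (l.mapIdx fun i c => addMark (i = y) c) := by
  induction l generalizing x with
  | nil =>
    simp only [val_nil, List.length_nil, not_lt_zero, false_and, exists_false, iff_false]
    exact fun h => h
  | cons c l ih =>
    have hc : (val (markHom ρ) [c]) = ⟨val ρ [addMark False c], {val ρ [addMark True c]}⟩ := by
      simp [val, markHom]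
    rw [val_cons, OneMarked.mem_mul_marked, val_markHom_plain, hc]
    simp only [ih, List.length_cons]
    constructor
    · rintro (⟨_, rfl, rfl⟩ | ⟨_, ⟨y, hy, rfl⟩, rfl⟩)
      · exact ⟨0, by omega, by simp [List.mapIdx_cons, ← val_cons, mapIdx_addMark_false]⟩
      · exact ⟨y + 1, by omega, by simp [List.mapIdx_cons, ← val_cons]⟩
    · rintro ⟨_ | y, hy, rfl⟩
      · exact Or.inl ⟨_, rfl, by simp [List.mapIdx_cons, ← val_cons, mapIdx_addMark_false]⟩
      · exact Or.inr ⟨_, ⟨y, by omega, rfl⟩, by simp [List.mapIdx_cons, ← val_cons]⟩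

theorem RecognizedFormula.all {φ : (wordVocabulary α).BoundedFormula Empty (n + 1)}
    (hφ : RecognizedFormula φ) : RecognizedFormula φ.all := by
  obtain ⟨M, _, _, hM, ρ, F, hF⟩ := hφ
  refine ⟨OneMarked M, inferInstance, inferInstance, OneMarked.isAperiodic hM, markHom ρ,
    {x | x.marked ⊆ F}, fun w v => ?_⟩
  change (∀ y : Fin w.length, RealizeIn w φ default (Fin.snoc v y)) ↔ _ ⊆ F
  simp only [hF, markedWord_snoc]
  constructor
  · intro h x hx
    obtain ⟨y, hy, rfl⟩ := (mem_val_markHom_marked ρ _ x).1 hx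
    exact h ⟨y, by simpa [markedWord] using hy⟩
  · intro h y
    exact h ((mem_val_markHom_marked ρ _ _).2 ⟨y, by simp [markedWord], rfl⟩)

theorem recognizedFormula (φ : (wordVocabulary α).BoundedFormula Empty n) :
    RecognizedFormula φ := by
  induction φ with
  | falsum =>
    refine ⟨Unit, inferInstance, inferInstance, fun _ _ _ _ _ _ => rfl, 1, ∅, fun w v => ?_⟩
    exact ⟨fun h => h.elim, fun h => h.elim⟩
  | equal t₁ t₂ => exact recognizedFormula_equal t₁ t₂
  | rel R ts => exact recognizedFormula_rel R ts
  | imp _ _ h₁ h₂ => exact h₁.imp h₂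
  | all _ h => exact h.all

end Marked

theorem foLanguages_subset_aperiodicLanguages (α : Type u) :
    foLanguages α ⊆ aperiodicLanguages α := by
  rintro _ ⟨φ, rfl⟩
  obtain ⟨M, _, _, hM, ρ, F, hF⟩ := recognizedFormula φ
  refine ⟨M, inferInstance, inferInstance, hM,
    ρ.comp (FreeMonoid.map fun a => (a, fun i : Fin 0 => i.elim0)), F, fun w => ?_⟩
  have hmark : markedWord w (Fin.elim0 : Fin 0 → Fin w.length) =
      w.map fun a => (a, fun i : Fin 0 => i.elim0) := by
    refine List.ext_getElem (by simp [markedWord]) fun i _ _ => ?_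
    simp only [markedWord, List.getElem_ofFn, List.getElem_map]
    exact Prod.ext rfl (Subsingleton.elim _ _)
  change Models w φ ↔ _
  rw [models_iff_realizeIn (x := default) (v := Fin.elim0), hF, hmark]
  rfl

/-! ### Star-free languages are first-order definable -/

section Relativization

variable {α : Type u}

/-- Rename the variables of a term so that a free variable, the cut position, is available. -/
def withCut {n : ℕ} (t : (wordVocabulary α).Term (Empty ⊕ Fin n)) :
    (wordVocabulary α).Term (Unit ⊕ Fin n) :=
  t.relabel (Sum.map Empty.elim id)

/-- The atomic formula saying that the last bound variable is smaller than the cut position. -/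
def beforeCut (n : ℕ) : (wordVocabulary α).BoundedFormula Unit (n + 1) :=
  Language.BoundedFormula.rel (WordRel.lt : (wordVocabulary α).Relations 2)
    ![Language.Term.var (Sum.inr (Fin.last n)), Language.Term.var (Sum.inl ())]

/-- Relativization of the quantifiers of a formula to the positions that satisfy the given guards,
one for each number of bound variables. -/
def relativize (guard : ∀ n, (wordVocabulary α).BoundedFormula Unit (n + 1)) :
    ∀ {n : ℕ}, (wordVocabulary α).BoundedFormula Empty n →
      (wordVocabulary α).BoundedFormula Unit n
  | _, .falsum => .falsum
  | _, .equal t₁ t₂ => .equal (withCut t₁) (withCut t₂)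
  | _, .rel R ts => .rel R fun i => withCut (ts i)
  | _, .imp φ ψ => (relativize guard φ).imp (relativize guard ψ)
  | n, .all φ => ((guard n).imp (relativize guard φ)).all

theorem realizeIn_beforeCut {w : List α} {n : ℕ} (x : Unit → Fin w.length)
    (v : Fin n → Fin w.length) (y : Fin w.length) :
    RealizeIn w (beforeCut n) x (Fin.snoc v y) ↔ y < x () := by
  change Fin.snoc (α := fun _ => Fin w.length) v y (Fin.last n) < x () ↔ _
  rw [Fin.snoc_last]

/-- If `u` is embedded in `w` as the set of positions satisfying the guard, then relativized
formulas express in `w` what the original formulas express in `u`. -/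
theorem realizeIn_relativize {u w : List α} (e : Fin u.length ↪o Fin w.length)
    (hlabel : ∀ i, w.get (e i) = u.get i) (x : Unit → Fin w.length)
    (guard : ∀ n, (wordVocabulary α).BoundedFormula Unit (n + 1))
    (hguard : ∀ (n : ℕ) (v : Fin n → Fin w.length) (y : Fin w.length),
      RealizeIn w (guard n) x (Fin.snoc v y) ↔ y ∈ Set.range e)
    {n : ℕ} (φ : (wordVocabulary α).BoundedFormula Empty n) (v : Fin n → Fin u.length) :
    RealizeIn w (relativize guard φ) x (e ∘ v) ↔ RealizeIn u φ default v := by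
  have hterm : ∀ {n : ℕ} (t : (wordVocabulary α).Term (Empty ⊕ Fin n)) (v : Fin n → Fin u.length),
      let _ := wordStructure u
      let _ := wordStructure w
      (withCut t).realize (Sum.elim x (e ∘ v)) =
        e (t.realize (Sum.elim (default : Empty → Fin u.length) v)) := by
    intro n t v
    obtain ⟨y | i, rfl⟩ := exists_eq_var t
    · exact y.elim
    · rfl
  induction φ with
  | falsum => rfl
  | equal t₁ t₂ =>
    let _ := wordStructure u
    let _ := wordStructure w
    change (withCut t₁).realize (Sum.elim x (e ∘ v)) = (withCut t₂).realize (Sum.elim x (e ∘ v)) ↔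
      t₁.realize (Sum.elim (default : Empty → Fin u.length) v) =
        t₂.realize (Sum.elim (default : Empty → Fin u.length) v)
    rw [hterm, hterm, e.injective.eq_iff]
  | rel R ts =>
    let _ := wordStructure u
    let _ := wordStructure w
    change wordRelMap w R (fun i => (withCut (ts i)).realize (Sum.elim x (e ∘ v))) ↔
      wordRelMap u R (fun i => (ts i).realize (Sum.elim (default : Empty → Fin u.length) v))
    simp only [hterm]
    cases R with
    | label a => simp only [wordRelMap, hlabel]
    | lt => simp only [wordRelMap, e.lt_iff_lt]
  | imp φ ψ hφ hψ => exact imp_congr (hφ v) (hψ v)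
  | @all n φ hφ =>
    change (∀ y : Fin w.length, RealizeIn w (guard n) x (Fin.snoc (e ∘ v) y) →
      RealizeIn w (relativize guard φ) x (Fin.snoc (e ∘ v) y)) ↔
        ∀ z : Fin u.length, RealizeIn u φ default (Fin.snoc v z)
    simp only [hguard, Set.forall_mem_range]
    refine forall_congr' fun z => ?_
    rw [← Fin.comp_snoc]
    exact hφ (Fin.snoc v z)

end Relativization

section Definability

variable {α : Type u}

theorem compl_mem_foLanguages {L : Language α} (h : L ∈ foLanguages α) : Lᶜ ∈ foLanguages α := by
  obtain ⟨φ, rfl⟩ := h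
  exact ⟨Language.BoundedFormula.imp φ .falsum, rfl⟩

theorem zero_mem_foLanguages : (0 : Language α) ∈ foLanguages α :=
  ⟨.falsum, rfl⟩

theorem add_mem_foLanguages {K L : Language α} (hK : K ∈ foLanguages α) (hL : L ∈ foLanguages α) :
    K + L ∈ foLanguages α := by
  obtain ⟨φ, rfl⟩ := hK
  obtain ⟨ψ, rfl⟩ := hL
  refine ⟨Language.BoundedFormula.imp (Language.BoundedFormula.imp φ .falsum) ψ, ?_⟩
  ext w
  change (¬ Models w φ → Models w ψ) ↔ (Models w φ ∨ Models w ψ)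
  tauto

/-- The formulas `φ` and `ψ`, relativized to the positions before the cut and to the remaining
positions, express that the two parts of the word satisfy `φ` and `ψ`. -/
theorem realizeIn_relativize_cut (φ ψ : (wordVocabulary α).Sentence) (w : List α)
    (y : Fin w.length) :
    RealizeIn w (relativize beforeCut φ ⊓ relativize (fun n => (beforeCut n).not) ψ)
      (fun _ : Unit => y) default ↔ Models (w.take y) φ ∧ Models (w.drop y) ψ := by
  have hdef : ∀ {k : ℕ} (e : Fin k → Fin w.length),
      (default : Fin 0 → Fin w.length) = e ∘ (default : Fin 0 → Fin k) :=
    fun _ => Subsingleton.elim _ _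
  have htake : (w.take y).length = y := by simp
  have hdrop : (w.drop y).length = w.length - y := by simp
  let e₁ : Fin (w.take y).length ↪o Fin w.length :=
    Fin.castLEOrderEmb (by simp)
  let e₂ : Fin (w.drop y).length ↪o Fin w.length :=
    OrderEmbedding.ofStrictMono (fun i => ⟨y + i, by have := i.2; omega⟩)
      fun i j hij => Nat.add_lt_add_left hij _
  have h₁ := realizeIn_relativize e₁ (fun i => by simp [e₁]) (fun _ => y) beforeCut
    (fun n v z => by
      rw [realizeIn_beforeCut]
      constructor
      · exact fun hz => ⟨⟨z, by rw [htake]; exact hz⟩, rfl⟩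
      · rintro ⟨i, rfl⟩
        exact Fin.lt_def.2 (i.2.trans_eq htake)) φ default
  have h₂ := realizeIn_relativize e₂ (fun i => by simp [e₂, OrderEmbedding.ofStrictMono])
    (fun _ => y)
    (fun n => (beforeCut n).not)
    (fun n v z => by
      change ¬ RealizeIn w (beforeCut n) _ _ ↔ _
      rw [realizeIn_beforeCut, not_lt]
      constructor
      · intro hz
        have hz' : (y : ℕ) ≤ z := hz
        exact ⟨⟨z - y, by have := z.2; omega⟩, Fin.ext (Nat.add_sub_cancel' hz')⟩
      · rintro ⟨i, rfl⟩
        exact Nat.le_add_right _ _) ψ default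
  rw [← hdef] at h₁ h₂
  rw [models_iff_realizeIn, models_iff_realizeIn, ← h₁, ← h₂]
  let _ := wordStructure w
  exact Language.BoundedFormula.realize_inf

/-- The words with a factorization into a word of `K` and a nonempty word of `L`; the cut is given
by the first position of the second factor. -/
def innerProduct (K L : Language α) : Language α :=
  {w | ∃ y : Fin w.length, w.take y ∈ K ∧ w.drop y ∈ L}

open Classical in
theorem mul_mem_foLanguages {K L : Language α} (hK : K ∈ foLanguages α) (hL : L ∈ foLanguages α) :
    K * L ∈ foLanguages α := by
  -- A factorization of `w` cuts it before one of its positions or at its end.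
  have hcut : K * L = innerProduct K L +
      (if [] ∈ L then K else 0) := by
    ext w
    rw [Language.mem_mul, Language.mem_add]
    constructor
    · rintro ⟨a, ha, b, hb, rfl⟩
      rcases b with _ | ⟨c, b⟩
      · right
        rw [if_pos hb]
        simpa using ha
      · left
        exact ⟨⟨a.length, by simp⟩, by simpa using ha, by simpa using hb⟩
    · rintro (⟨y, ha, hb⟩ | h)
      · exact ⟨_, ha, _, hb, by simp⟩
      · split_ifs at h with hnil
        · exact ⟨w, h, [], hnil, by simp⟩
        · exact (Language.notMem_zero w h).elim
  rw [hcut]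
  refine add_mem_foLanguages ?_ ?_
  · obtain ⟨φ, rfl⟩ := hK
    obtain ⟨ψ, rfl⟩ := hL
    let χ : (wordVocabulary α).BoundedFormula Empty 1 := Language.BoundedFormula.relabel
      (fun _ => Sum.inr 0) (relativize beforeCut φ ⊓ relativize (fun n => (beforeCut n).not) ψ)
    refine ⟨χ.ex, ?_⟩
    ext w
    let _ := wordStructure w
    change (χ.ex).Realize (default : Empty → Fin w.length) default ↔
      ∃ y : Fin w.length, Models (w.take y) φ ∧ Models (w.drop y) ψ
    rw [Language.BoundedFormula.realize_ex]
    refine exists_congr fun y => ?_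
    rw [← realizeIn_relativize_cut]
    refine (Language.BoundedFormula.realize_relabel (n := 0) (m := 1)).trans ?_
    have h1 : ∀ f g : Unit → Fin w.length, f () = g () → f = g := fun f g h => funext fun _ => h
    refine iff_of_eq (congrArg₂ (Language.BoundedFormula.Realize _) (h1 _ _ ?_)
      (Subsingleton.elim _ _))
    rfl
  · split_ifs
    · exact hK
    · exact zero_mem_foLanguages

/-- The one-letter word `a` is described by `∃ x, Q_a x ∧ ∀ y, y = x`. -/
theorem letter_mem_foLanguages (a : α) : ({[a]} : Language α) ∈ foLanguages α := by
  let χ : (wordVocabulary α).BoundedFormula Empty 1 :=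
    Language.BoundedFormula.rel (WordRel.label a : (wordVocabulary α).Relations 1)
      (fun _ => Language.Term.var (Sum.inr 0)) ⊓
    Language.BoundedFormula.all (Language.BoundedFormula.equal
      (Language.Term.var (Sum.inr 1)) (Language.Term.var (Sum.inr 0)))
  refine ⟨χ.ex, ?_⟩
  ext w
  let _ := wordStructure w
  change (χ.ex).Realize (default : Empty → Fin w.length) default ↔ w = [a]
  rw [Language.BoundedFormula.realize_ex]
  simp only [χ, Language.BoundedFormula.realize_inf, Language.BoundedFormula.realize_all]
  change (∃ x : Fin w.length, w.get x = a ∧ ∀ y : Fin w.length, y = x) ↔ _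
  constructor
  · rintro ⟨x, rfl, hx⟩
    rcases w with _ | ⟨b, _ | ⟨c, w⟩⟩
    · exact x.elim0
    · rw [Subsingleton.elim (α := Fin 1) x ⟨0, by simp⟩]
      rfl
    · have h := (hx ⟨0, by simp⟩).trans (hx ⟨1, by simp⟩).symm
      simp at h
  · rintro rfl
    exact ⟨⟨0, by simp⟩, rfl, fun y => Subsingleton.elim (α := Fin 1) _ _⟩

theorem starFreeLanguages_subset_foLanguages (α : Type u) :
    starFreeLanguages α ⊆ foLanguages α := by
  intro L hL
  induction hL with
  | empty => exact zero_mem_foLanguages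
  | letter a => exact letter_mem_foLanguages a
  | union _ _ h₁ h₂ => exact add_mem_foLanguages h₁ h₂
  | concat _ _ h₁ h₂ => exact mul_mem_foLanguages h₁ h₂
  | compl _ h => exact compl_mem_foLanguages h

end Definability

theorem foLanguages_eq_aperiodicLanguages (α : Type u) [Finite α] :
    foLanguages α = aperiodicLanguages α :=
  (foLanguages_subset_aperiodicLanguages α).antisymm fun _ hL =>
    starFreeLanguages_subset_foLanguages α (isStarFree_of_mem_aperiodicLanguages hL)

theorem aperiodicLanguages_eq_starFreeLanguages (α : Type u) [Finite α] :
    aperiodicLanguages α = starFreeLanguages α :=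
  Set.Subset.antisymm (fun _ hL => isStarFree_of_mem_aperiodicLanguages hL) fun _ hL =>
    foLanguages_subset_aperiodicLanguages α (starFreeLanguages_subset_foLanguages α hL)

end FOWords

namespace FOWords

/-! ### A bounded test for aperiodicity -/

theorem exists_lt_map_eq_of_card {M : Type v} [Finite M] (f : ℕ → M) :
    ∃ i j, i < j ∧ j ≤ Nat.card M ∧ f i = f j := by
  by_contra! h
  have hinj : Function.Injective fun i : Fin (Nat.card M + 1) => f i := by
    intro i j hij
    by_contra hne
    rcases lt_or_gt_of_ne hne with hlt | hlt
    · exact h i j hlt (Nat.lt_succ_iff.1 j.2) hij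
    · exact h j i hlt (Nat.lt_succ_iff.1 i.2) hij.symm
  have := Nat.card_le_card_of_injective _ hinj
  simp at this

/-- Every value of a homomorphism to a finite monoid is attained on a short word: cut out the
infix between two prefixes with equal values. -/
theorem exists_short_word {α : Type u} {M : Type v} [Monoid M] [Finite M]
    (ρ : FreeMonoid α →* M) (w : List α) :
    ∃ w' : List α, w'.length ≤ Nat.card M ∧ val ρ w' = val ρ w := by
  induction hl : w.length using Nat.strong_induction_on generalizing w with
  | _ l ih =>
  subst hl
  by_cases hw : w.length ≤ Nat.card M
  · exact ⟨w, hw, rfl⟩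
  obtain ⟨i, j, hij, hj, h⟩ := exists_lt_map_eq_of_card fun i => val ρ (w.take i)
  obtain ⟨w', hw', hval⟩ := ih (w.take i ++ w.drop j).length (by simp; omega)
    (w.take i ++ w.drop j) rfl
  refine ⟨w', hw', hval.trans ?_⟩
  rw [val_append, h, ← val_append, List.take_append_drop]

/-- The word `x` repeated `n` times. -/
def repeatWord {β : Type u} (x : List β) (n : ℕ) : List β := (List.range n).flatMap fun _ => x

theorem ofList_repeatWord {β : Type u} (x : List β) (n : ℕ) :
    FreeMonoid.ofList (repeatWord x n) = FreeMonoid.ofList x ^ n := by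
  induction n with
  | zero => rfl
  | succ n ih =>
    rw [pow_succ, ← ih, repeatWord, List.range_succ, List.flatMap_append,
      ← FreeMonoid.ofList_append]
    simp [repeatWord]

/-- Whether a language with a finite recognizing monoid is aperiodic is visible on repetitions of
short words, the exponent and the lengths being bounded by the size of the monoid. -/
theorem mem_aperiodicLanguages_iff_bounded {α : Type u} {M : Type v} [Monoid M] [Finite M]
    {L : Language α} (h : Recognizes M L) {N : ℕ} (hN : Nat.card M = N) :
    L ∈ aperiodicLanguages α ↔ ∀ u x v : List α, u.length ≤ N → x.length ≤ N → v.length ≤ N →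
      (u ++ repeatWord x N ++ v ∈ L ↔ u ++ repeatWord x (N + 1) ++ v ∈ L) := by
  have hfin := finite_syntacticMonoid_of_recognizes h
  obtain ⟨ρ, F, hF⟩ := h
  subst hN
  rw [mem_aperiodicLanguages_iff, isAperiodic_iff_exists_pow, and_iff_right hfin]
  have hofList : ∀ (u x v : List α) n, u ++ repeatWord x n ++ v =
      FreeMonoid.toList (FreeMonoid.ofList u * FreeMonoid.ofList x ^ n * FreeMonoid.ofList v) := by
    intro u x v n
    rw [← ofList_repeatWord]
    rfl
  constructor
  · intro hper u x v _ _ _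
    obtain ⟨n, hn⟩ := hper ((syntacticCon L).mk' (FreeMonoid.ofList x))
    obtain ⟨i, j, hij, hj, hpow⟩ := exists_lt_map_eq_of_card fun i => ρ (FreeMonoid.ofList x) ^ i
    have hpow' : (syntacticCon L).mk' (FreeMonoid.ofList x) ^ i =
        (syntacticCon L).mk' (FreeMonoid.ofList x) ^ j := by
      rw [← map_pow (syntacticCon L).mk', ← map_pow (syntacticCon L).mk']
      exact (Con.eq _).2 (syntacticCon_of_recognizes hF (by simpa using hpow))
    have hstab := pow_stable_of_pow_eq hij hpow' hn (hij.le.trans hj)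
    rw [← map_pow (syntacticCon L).mk', ← map_pow (syntacticCon L).mk'] at hstab
    have hcon : syntacticCon L _ _ := (Con.eq _).1 hstab
    rw [hofList, hofList]
    exact hcon (FreeMonoid.ofList u) (FreeMonoid.ofList v)
  · intro hshort q
    obtain ⟨x, rfl⟩ := (syntacticCon L).mk'_surjective q
    refine ⟨Nat.card M, ?_⟩
    rw [← map_pow, ← map_pow]
    refine (Con.eq _).2 fun u v => ?_
    obtain ⟨u', hu', hu⟩ := exists_short_word ρ (FreeMonoid.toList u)
    obtain ⟨x', hx', hx⟩ := exists_short_word ρ (FreeMonoid.toList x)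
    obtain ⟨v', hv', hv⟩ := exists_short_word ρ (FreeMonoid.toList v)
    have key := hshort u' x' v' hu' hx' hv'
    simp only [val, FreeMonoid.ofList_toList] at hu hx hv
    rw [hofList, hofList, hF, hF] at key
    rw [hF, hF]
    simpa only [FreeMonoid.ofList_toList, map_mul, map_pow, hu, hx, hv] using key

/-! ### The transition monoid of an automaton -/

section Transition

variable {α : Type u} {σ : Type v} (A : NFA α σ)

/-- The action of words on sets of states; words act from left to right, hence the opposite
monoid. -/
def transitionHom : FreeMonoid α →* (Function.End (Set σ))ᵐᵒᵖ :=
  FreeMonoid.lift fun a => MulOpposite.op fun S => A.stepSet S a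

theorem transitionHom_apply (w : List α) (S : Set σ) :
    (val (transitionHom A) w).unop S = A.evalFrom S w := by
  induction w generalizing S with
  | nil => rfl
  | cons a w ih =>
    rw [val_cons, NFA.evalFrom_cons, ← ih]
    rfl

instance [Finite σ] : Finite (Function.End (Set σ))ᵐᵒᵖ :=
  Finite.of_equiv (Set σ → Set σ) MulOpposite.opEquiv

theorem recognizes_accepts : Recognizes (Function.End (Set σ))ᵐᵒᵖ A.accepts := by
  refine ⟨transitionHom A, {f | ∃ q ∈ A.accept, q ∈ f.unop A.start}, fun w => ?_⟩
  change (∃ q ∈ A.accept, q ∈ A.eval w) ↔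
    ∃ q ∈ A.accept, q ∈ (val (transitionHom A) w).unop A.start
  rw [transitionHom_apply]
  rfl

theorem card_transitionMonoid (n : ℕ) :
    Nat.card (Function.End (Set (Fin n)))ᵐᵒᵖ = (2 ^ n) ^ (2 ^ n) := by
  rw [Nat.card_congr MulOpposite.opEquiv.symm]
  change Nat.card (Set (Fin n) → Set (Fin n)) = _
  simp

end Transition

/-! ### The decision procedure -/

namespace AutomatonCode

/-- The states reached from the states in `S` by reading the letter `a`. -/
def stepList (c : AutomatonCode) (S : List ℕ) (a : ℕ) : List ℕ :=
  (c.2.2.1.filter fun t => t.1 ∈ S ∧ t.2.1 = a ∧ t.2.2 < c.states).map fun t => t.2.2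

/-- The states reached from the initial states by reading the word `w`. -/
def runList (c : AutomatonCode) (w : List ℕ) : List ℕ :=
  w.foldl c.stepList (c.2.2.2.1.filter fun q => q < c.states)

/-- Acceptance of a word, given as a list of numbers. -/
def AcceptsList (c : AutomatonCode) (w : List ℕ) : Prop :=
  ∃ q ∈ c.runList w, q ∈ c.2.2.2.2

theorem mem_runList (c : AutomatonCode) (w : List (Fin c.letters)) (q : ℕ) :
    q ∈ c.runList (w.map Fin.val) ↔
      ∃ h : q < c.states, (⟨q, h⟩ : Fin c.states) ∈ c.toNFA.eval w := by
  induction w using List.reverseRecOn generalizing q with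
  | nil =>
    simp [runList, toNFA, and_comm]
  | append_singleton w a ih =>
    rw [NFA.eval_append_singleton, List.map_append, runList, List.foldl_append]
    change q ∈ c.stepList (c.runList (w.map Fin.val)) a ↔ _
    simp only [NFA.mem_stepSet, stepList, List.mem_map, List.mem_filter, ih, decide_eq_true_eq]
    constructor
    · rintro ⟨⟨p, b, r⟩, ⟨ht, ⟨hp, hpe⟩, rfl, hr⟩, rfl⟩
      exact ⟨hr, ⟨p, hp⟩, hpe, ht⟩
    · rintro ⟨hq, p, hp, ht⟩
      exact ⟨(p, a, q), ⟨ht, ⟨p.2, hp⟩, rfl, hq⟩, rfl⟩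

theorem acceptsList_map_val (c : AutomatonCode) (w : List (Fin c.letters)) :
    c.AcceptsList (w.map Fin.val) ↔ w ∈ c.toNFA.accepts := by
  simp only [AcceptsList, mem_runList]
  constructor
  · rintro ⟨q, ⟨hq, he⟩, ha⟩
    exact ⟨⟨q, hq⟩, ha, he⟩
  · rintro ⟨q, ha, he⟩
    exact ⟨q, ⟨q.2, he⟩, ha⟩

end AutomatonCode

/-- All words of length at most `l` over the letters `0, …, k-1`. -/
def wordsUpTo (k : ℕ) : ℕ → List (List ℕ)
  | 0 => [[]]
  | l + 1 => [] :: (wordsUpTo k l).flatMap fun w => (List.range k).map fun a => a :: w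

theorem mem_wordsUpTo {k l : ℕ} {w : List ℕ} :
    w ∈ wordsUpTo k l ↔ w.length ≤ l ∧ ∀ a ∈ w, a < k := by
  induction l generalizing w with
  | zero =>
    simp only [wordsUpTo, List.mem_singleton, Nat.le_zero, List.length_eq_zero_iff]
    exact ⟨fun h => ⟨h, by simp [h]⟩, fun h => h.1⟩
  | succ l ih =>
    rcases w with _ | ⟨a, w⟩
    · simp [wordsUpTo]
    · simp only [wordsUpTo, List.mem_cons, reduceCtorEq, List.mem_flatMap, List.mem_map,
        List.mem_range, ih, false_or, List.length_cons, Nat.add_le_add_iff_right,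
        forall_eq_or_imp, List.cons.injEq]
      constructor
      · rintro ⟨w', ⟨hl, hw⟩, a', ha, rfl, rfl⟩
        exact ⟨hl, ha, hw⟩
      · rintro ⟨hl, ha, hw⟩
        exact ⟨w, ⟨hl, hw⟩, a, ha, rfl, rfl⟩

theorem exists_map_val_eq {k : ℕ} {w : List ℕ} (hw : ∀ a ∈ w, a < k) :
    ∃ w' : List (Fin k), w'.map Fin.val = w :=
  ⟨w.attach.map fun a => ⟨a.1, hw a.1 a.2⟩, by simp⟩

theorem map_repeatWord {β : Type u} {γ : Type v} (f : β → γ) (x : List β) (n : ℕ) :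
    (repeatWord x n).map f = repeatWord (x.map f) n := by
  simp [repeatWord, List.map_flatMap]

namespace AutomatonCode

/-- The number of transformations of the set of sets of states. -/
def bound (c : AutomatonCode) : ℕ := (2 ^ c.states) ^ (2 ^ c.states)

/-- The finite test: repeating a short infix once more does not change acceptance. -/
def Test (c : AutomatonCode) : Prop :=
  ∀ u ∈ wordsUpTo c.letters c.bound, ∀ x ∈ wordsUpTo c.letters c.bound,
    ∀ v ∈ wordsUpTo c.letters c.bound,
      (c.AcceptsList (u ++ repeatWord x c.bound ++ v) ↔
        c.AcceptsList (u ++ repeatWord x (c.bound + 1) ++ v))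

theorem accepts_mem_foLanguages_iff (c : AutomatonCode) :
    c.toNFA.accepts ∈ foLanguages (Fin c.letters) ↔ c.Test := by
  rw [foLanguages_eq_aperiodicLanguages, mem_aperiodicLanguages_iff_bounded
    (recognizes_accepts c.toNFA) (card_transitionMonoid c.states)]
  change (∀ u x v : List (Fin c.letters), u.length ≤ c.bound → x.length ≤ c.bound →
    v.length ≤ c.bound → (u ++ repeatWord x c.bound ++ v ∈ c.toNFA.accepts ↔
      u ++ repeatWord x (c.bound + 1) ++ v ∈ c.toNFA.accepts)) ↔ c.Test
  simp only [← acceptsList_map_val, List.map_append, map_repeatWord]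
  constructor
  · intro h u hu x hx v hv
    rw [mem_wordsUpTo] at hu hx hv
    obtain ⟨u, rfl⟩ := exists_map_val_eq hu.2
    obtain ⟨x, rfl⟩ := exists_map_val_eq hx.2
    obtain ⟨v, rfl⟩ := exists_map_val_eq hv.2
    exact h u x v (by simpa using hu.1) (by simpa using hx.1) (by simpa using hv.1)
  · intro h u x v hu hx hv
    have hmem : ∀ w : List (Fin c.letters), w.length ≤ c.bound →
        w.map Fin.val ∈ wordsUpTo c.letters c.bound := fun w hw =>
      mem_wordsUpTo.2 ⟨by simpa using hw, by simp⟩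
    exact h _ (hmem u hu) _ (hmem x hx) _ (hmem v hv)

end AutomatonCode

/-! ### Primitive recursiveness of the test -/

theorem primrecRel_mem_list : PrimrecRel fun (q : ℕ) (S : List ℕ) => q ∈ S :=
  (PrimrecRel.exists_mem_list (Primrec.eq (α := ℕ))).swap.of_eq fun q S => by simp [Function.swap]

theorem primrec₂_repeatWord : Primrec₂ (repeatWord (β := ℕ)) :=
  Primrec.list_flatMap (Primrec.list_range.comp Primrec.snd) (Primrec.fst.comp Primrec.fst)

theorem primrec₂_wordsUpTo : Primrec₂ wordsUpTo := by
  have hext : Primrec₂ fun (p : ℕ × ℕ × List (List ℕ)) (w : List ℕ) =>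
      (List.range p.1).map fun a => a :: w :=
    Primrec.list_map (Primrec.list_range.comp (Primrec.fst.comp Primrec.fst))
      (Primrec.list_cons.comp Primrec.snd (Primrec.snd.comp Primrec.fst))
  have hstep : Primrec₂ fun (k : ℕ) (p : ℕ × List (List ℕ)) =>
      ([] : List ℕ) :: p.2.flatMap fun w => (List.range k).map fun a => a :: w :=
    Primrec.list_cons.comp (Primrec.const [])
      (Primrec.list_flatMap (Primrec.snd.comp Primrec.snd) hext)
  refine (Primrec.nat_rec (Primrec.const [([] : List ℕ)]) hstep).of_eq fun k l => ?_
  induction l with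
  | zero => rfl
  | succ l ih => simp only [wordsUpTo, ← ih]

namespace AutomatonCode

theorem primrec_states : Primrec AutomatonCode.states := Primrec.fst.comp Primrec.snd

theorem primrec_transitions : Primrec fun c : AutomatonCode => c.2.2.1 :=
  Primrec.fst.comp (Primrec.snd.comp Primrec.snd)

theorem primrec_initial : Primrec fun c : AutomatonCode => c.2.2.2.1 :=
  Primrec.fst.comp (Primrec.snd.comp (Primrec.snd.comp Primrec.snd))

theorem primrec_accepting : Primrec fun c : AutomatonCode => c.2.2.2.2 :=
  Primrec.snd.comp (Primrec.snd.comp (Primrec.snd.comp Primrec.snd))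

theorem primrec_bound : Primrec bound := by
  have hpow : Primrec₂ ((· ^ ·) : ℕ → ℕ → ℕ) := Primrec₂.unpaired'.1 Nat.Primrec.pow
  have h := hpow.comp (Primrec.const 2) primrec_states
  exact hpow.comp h h

theorem primrec_stepList :
    Primrec fun p : (AutomatonCode × List ℕ) × ℕ => stepList p.1.1 p.1.2 p.2 := by
  have hR : PrimrecRel fun (t : ℕ × ℕ × ℕ) (b : List ℕ × ℕ × ℕ) =>
      t.1 ∈ b.1 ∧ t.2.1 = b.2.1 ∧ t.2.2 < b.2.2 :=
    (primrecRel_mem_list.comp (Primrec.fst.comp Primrec.fst)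
      (Primrec.fst.comp Primrec.snd)).and <|
    (Primrec.eq.comp (Primrec.fst.comp (Primrec.snd.comp Primrec.fst))
      (Primrec.fst.comp (Primrec.snd.comp Primrec.snd))).and
    (Primrec.nat_lt.comp (Primrec.snd.comp (Primrec.snd.comp Primrec.fst))
      (Primrec.snd.comp (Primrec.snd.comp Primrec.snd)))
  have hcode : Primrec fun p : (AutomatonCode × List ℕ) × ℕ => p.1.1 :=
    Primrec.fst.comp Primrec.fst
  have hfilter := hR.listFilter.comp (primrec_transitions.comp hcode)
    (Primrec.pair (Primrec.snd.comp Primrec.fst)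
      (Primrec.pair Primrec.snd (primrec_states.comp hcode)))
  have htarget : Primrec₂ fun (_ : (AutomatonCode × List ℕ) × ℕ) (t : ℕ × ℕ × ℕ) => t.2.2 :=
    Primrec.snd.comp (Primrec.snd.comp Primrec.snd)
  exact (Primrec.list_map hfilter htarget).of_eq fun p => rfl

theorem primrec₂_runList : Primrec₂ runList := by
  have hinit : Primrec fun p : AutomatonCode × List ℕ =>
      p.1.2.2.2.1.filter fun q => q < p.1.states :=
    Primrec.nat_lt.listFilter.comp (primrec_initial.comp Primrec.fst)
      (primrec_states.comp Primrec.fst)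
  have harg : Primrec fun r : (AutomatonCode × List ℕ) × List ℕ × ℕ =>
      ((r.1.1, r.2.1), r.2.2) :=
    Primrec.pair (Primrec.pair (Primrec.fst.comp Primrec.fst) (Primrec.fst.comp Primrec.snd))
      (Primrec.snd.comp Primrec.snd)
  have hcomp := primrec_stepList.comp harg
  have hstep : Primrec₂ fun (p : AutomatonCode × List ℕ) (q : List ℕ × ℕ) =>
      stepList p.1 q.1 q.2 := hcomp
  have hfold := Primrec.list_foldl (Primrec.snd (α := AutomatonCode) (β := List ℕ)) hinit hstep
  exact hfold

theorem primrecRel_acceptsList : PrimrecRel AcceptsList :=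
  primrecRel_mem_list.exists_mem_list.comp primrec₂_runList
    (primrec_accepting.comp Primrec.fst)

theorem primrecPred_test : PrimrecPred Test := by
  have hwords : Primrec fun c : AutomatonCode => wordsUpTo c.letters c.bound :=
    primrec₂_wordsUpTo.comp Primrec.fst primrec_bound
  have hacc : ∀ {f : AutomatonCode → ℕ}, Primrec f → PrimrecPred
      fun p : List ℕ × List ℕ × List ℕ × AutomatonCode =>
        p.2.2.2.AcceptsList (p.2.2.1 ++ repeatWord p.2.1 (f p.2.2.2) ++ p.1) := by
    intro f hf
    have hc : Primrec fun p : List ℕ × List ℕ × List ℕ × AutomatonCode => p.2.2.2 :=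
      Primrec.snd.comp (Primrec.snd.comp Primrec.snd)
    exact primrecRel_acceptsList.comp hc (Primrec.list_append.comp
      (Primrec.list_append.comp (Primrec.fst.comp (Primrec.snd.comp Primrec.snd))
        (primrec₂_repeatWord.comp (Primrec.fst.comp Primrec.snd) (hf.comp hc))) Primrec.fst)
  have h₀ := hacc primrec_bound
  have h₁ := hacc (Primrec.succ.comp primrec_bound)
  have h₂ : PrimrecRel fun (v : List ℕ) (p : List ℕ × List ℕ × AutomatonCode) =>
      (p.2.2.AcceptsList (p.2.1 ++ repeatWord p.1 p.2.2.bound ++ v) ↔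
        p.2.2.AcceptsList (p.2.1 ++ repeatWord p.1 (p.2.2.bound + 1) ++ v)) :=
    ((h₀.and h₁).or (h₀.not.and h₁.not)).of_eq fun _ => iff_iff_and_or_not_and_not.symm
  have h₃ : PrimrecRel fun (x : List ℕ) (p : List ℕ × AutomatonCode) =>
      ∀ v ∈ wordsUpTo p.2.letters p.2.bound,
        (p.2.AcceptsList (p.1 ++ repeatWord x p.2.bound ++ v) ↔
          p.2.AcceptsList (p.1 ++ repeatWord x (p.2.bound + 1) ++ v)) :=
    h₂.forall_mem_list.comp (hwords.comp (Primrec.snd.comp Primrec.snd)) Primrec.id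
  have h₄ : PrimrecRel fun (u : List ℕ) (c : AutomatonCode) =>
      ∀ x ∈ wordsUpTo c.letters c.bound, ∀ v ∈ wordsUpTo c.letters c.bound,
        (c.AcceptsList (u ++ repeatWord x c.bound ++ v) ↔
          c.AcceptsList (u ++ repeatWord x (c.bound + 1) ++ v)) :=
    h₃.forall_mem_list.comp (hwords.comp Primrec.snd) Primrec.id
  exact h₄.forall_mem_list.comp hwords Primrec.id

end AutomatonCode

end FOWords

theorem mainTheorem3 :
    (∀ (α : Type u) [Finite α],
      FOWords.foLanguages α = FOWords.aperiodicLanguages α ∧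
      FOWords.aperiodicLanguages α = FOWords.starFreeLanguages α ∧
      ∀ L : Language α, L ∈ FOWords.foLanguages α ↔
        Finite (FOWords.SyntacticMonoid L) ∧
          FOWords.IsAperiodic (FOWords.SyntacticMonoid L)) ∧
    ComputablePred (fun c : FOWords.AutomatonCode =>
      c.toNFA.accepts ∈ FOWords.foLanguages (Fin c.letters)) := by
  refine ⟨fun α _ => ⟨FOWords.foLanguages_eq_aperiodicLanguages α,
    FOWords.aperiodicLanguages_eq_starFreeLanguages α, fun L => ?_⟩, ?_⟩
  · rw [FOWords.foLanguages_eq_aperiodicLanguages, FOWords.mem_aperiodicLanguages_iff]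
  · exact FOWords.AutomatonCode.primrecPred_test.computablePred.of_eq fun c =>
      (FOWords.AutomatonCode.accepts_mem_foLanguages_iff c).symm
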